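/- Let $(T,d)$ be a metric space. Call $T$ a *real tree* if it is non-empty and 1. for all $x,y\in T$ there is a unique isometric embedding $\varphi_{x,y}:[0,d(x,y)]\to T$ with $\varphi_{x,y}(0)=x$ and $\varphi_{x,y}(d(x,y))=y$; and 2. for every injective continuous map $\psi:[0,1]\to T$, the image $\psi([0,1])$ equals $[\psi(0),\psi(1)]$, where $[x,y]:=\varphi_{x,y}([0,d(x,y)])$. **Theorem.** A metric space $(T,d)$ is a real tree if and only if $T$ is connected (connected spaces being non-empty by convention) and, for all $x,y,z,w\in T$, $$d(x,y)+d(z,w)\le \max\bigl(d(x,z)+d(y,w),\; d(x,w)+d(y,z)\bigr).$$ -/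

import Mathlib

/-- `φ` is an isometric embedding of the closed interval `[0, d(x,y)] ⊆ ℝ` into `T` with
`φ 0 = x` and `φ (d(x,y)) = y`. -/
structure IsGeodesicFromTo {T : Type*} [MetricSpace T] (x y : T)
    (φ : Set.Icc (0 : ℝ) (dist x y) → T) : Prop where
  isometry : Isometry φ
  map_left : φ ⟨0, Set.left_mem_Icc.2 dist_nonneg⟩ = x
  map_right : φ ⟨dist x y, Set.right_mem_Icc.2 dist_nonneg⟩ = y

/-- The segment `[x, y]`: the set of points on isometric embeddings of `[0, d(x,y)]` from `x`
to `y`. When this embedding exists and is unique, this is its image, see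
`geodesicSegment_eq_range`. -/
def geodesicSegment {T : Type*} [MetricSpace T] (x y : T) : Set T :=
  {z | ∃ φ : Set.Icc (0 : ℝ) (dist x y) → T, IsGeodesicFromTo x y φ ∧ z ∈ Set.range φ}

/-- A real tree: a non-empty metric space in which any two points `x`, `y` are joined by a unique
isometric embedding of `[0, d(x,y)]`, and in which every injective continuous path has the
segment between its endpoints as its image. -/
structure IsRealTree (T : Type*) [MetricSpace T] : Prop where
  nonempty : Nonempty T
  existsUnique_geodesic : ∀ x y : T,
    ∃! φ : Set.Icc (0 : ℝ) (dist x y) → T, IsGeodesicFromTo x y φ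
  range_eq_segment : ∀ ψ : Set.Icc (0 : ℝ) 1 → T, Continuous ψ → Function.Injective ψ →
    Set.range ψ = geodesicSegment (ψ 0) (ψ 1)

theorem geodesicSegment_eq_range {T : Type*} [MetricSpace T] {x y : T}
    (h : ∃! φ : Set.Icc (0 : ℝ) (dist x y) → T, IsGeodesicFromTo x y φ)
    {φ : Set.Icc (0 : ℝ) (dist x y) → T} (hφ : IsGeodesicFromTo x y φ) :
    geodesicSegment x y = Set.range φ := by
  ext z
  constructor
  · rintro ⟨φ', h', hz⟩
    rwa [h.unique hφ h']
  · intro hz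
    exact ⟨φ, hφ, hz⟩

/-! Four-point to tree: a gap at distance `t` on the way from `x` to `y` would make a sublevel set
of a Gromov product clopen (`exists_dist_eq`). The inequality makes the point at each distance
unique, and these points form the geodesic. The gap argument also runs inside any connected subset,
so paths cover segments; medians and injectivity give the converse. Tree to four-point: arcs are
segments, so triples have medians. Two medians on a common segment give the inequality. -/

/-- Buneman's four-point condition on a pseudometric space. -/
def FourPointCondition (T : Type*) [PseudoMetricSpace T] : Prop :=
  ∀ x y z w : T, dist x y + dist z w ≤ max (dist x z + dist y w) (dist x w + dist y z)

/-! ### From the four-point condition to real trees -/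

section FourPoint

variable {T : Type*} [MetricSpace T]

theorem FourPointCondition.subtype (h : FourPointCondition T) (S : Set T) :
    FourPointCondition S :=
  fun x y z w => h x y z w

/-- In a connected space with the four-point condition, the set of points whose Gromov product
with `y` based at `x` is at most `t` would be clopen if `[x, y]` had a gap at distance `t`. -/
theorem FourPointCondition.exists_dist_eq [PreconnectedSpace T] (h : FourPointCondition T)
    (x y : T) {t : ℝ} (ht : t ∈ Set.Icc 0 (dist x y)) :
    ∃ z, dist x z = t ∧ dist z y = dist x y - t := by
  by_contra! hgap
  have hclosed : IsClosed {z | dist x y + dist x z - dist y z ≤ 2 * t} :=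
    isClosed_le (by fun_prop) (by fun_prop)
  have hopen : IsOpen {z | dist x y + dist x z - dist y z ≤ 2 * t} := by
    rw [isOpen_iff_mem_nhds]
    intro z hz
    rcases lt_or_eq_of_le (Set.mem_ofPred_eq ▸ hz) with hlt | heq
    · have : IsOpen {z | dist x y + dist x z - dist y z < 2 * t} :=
        isOpen_lt (by fun_prop) (by fun_prop)
      refine Filter.mem_of_superset (this.mem_nhds hlt) fun w hw => ?_
      exact le_of_lt (Set.mem_ofPred_eq ▸ hw)
    -- At product exactly `t`, the absence of a gap point forces `dist x z > t`; this slack is the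
    -- radius of the ball.
    · have hpos : 0 < dist x z - t := by
        have h1 : 0 ≤ dist x z - t := by
          have := dist_triangle x z y
          rw [dist_comm z y] at this
          linarith
        refine lt_of_le_of_ne h1 fun h0 => hgap z (by linarith) ?_
        rw [dist_comm z y]
        linarith
      refine Filter.mem_of_superset (Metric.ball_mem_nhds z hpos) fun w hw => ?_
      rw [Metric.mem_ball] at hw
      have h1 := h x w y z
      have h2 := dist_triangle x w z
      simp only [Set.mem_ofPred_eq]
      rcases le_max_iff.1 h1 with h1 | h1
      · linarith
      · rw [dist_comm w y] at h1
        linarith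
  have huniv := IsClopen.eq_univ ⟨hclosed, hopen⟩ ⟨x, by simpa [dist_comm y x] using ht.1⟩
  have hy : y ∈ {z | dist x y + dist x z - dist y z ≤ 2 * t} := huniv ▸ Set.mem_univ y
  have hle : dist x y ≤ t := by
    have : dist x y + dist x y - dist y y ≤ 2 * t := hy
    rw [dist_self] at this
    linarith
  have hty : t = dist x y := le_antisymm ht.2 hle
  exact hgap y hty.symm (by simp [hty])

/-- Two points of a metric segment in a four-point space are at the expected distance. -/
theorem FourPointCondition.dist_eq_abs_sub (h : FourPointCondition T) {x y p q : T} {s t : ℝ}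
    (hp : dist x p = s) (hp' : dist p y = dist x y - s)
    (hq : dist x q = t) (hq' : dist q y = dist x y - t) : dist p q = |s - t| := by
  apply le_antisymm
  · have h1 := h p q x y
    rw [dist_comm p x, dist_comm q x, hp, hp', hq, hq'] at h1
    rcases le_max_iff.1 h1 with h1 | h1
    · linarith [le_abs_self (s - t)]
    · linarith [neg_abs_le (s - t)]
  · rw [← hp, ← hq, dist_comm x p, dist_comm x q]
    exact abs_dist_sub_le p q x

theorem IsGeodesicFromTo.dist_left {x y : T} {φ : Set.Icc (0 : ℝ) (dist x y) → T}
    (hφ : IsGeodesicFromTo x y φ) (t : Set.Icc (0 : ℝ) (dist x y)) : dist x (φ t) = t := by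
  conv_lhs => rw [← hφ.map_left]
  rw [hφ.isometry.dist_eq, Subtype.dist_eq, Real.dist_eq]
  simp [abs_of_nonneg t.2.1]

theorem IsGeodesicFromTo.dist_right {x y : T} {φ : Set.Icc (0 : ℝ) (dist x y) → T}
    (hφ : IsGeodesicFromTo x y φ) (t : Set.Icc (0 : ℝ) (dist x y)) :
    dist (φ t) y = dist x y - t := by
  conv_lhs => rw [← hφ.map_right]
  rw [hφ.isometry.dist_eq, Subtype.dist_eq, Real.dist_eq, abs_sub_comm]
  exact abs_of_nonneg (sub_nonneg.2 t.2.2)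

theorem dist_add_dist_of_mem_geodesicSegment {x y z : T} (hz : z ∈ geodesicSegment x y) :
    dist x z + dist z y = dist x y := by
  obtain ⟨φ, hφ, t, rfl⟩ := hz
  rw [hφ.dist_left, hφ.dist_right]
  ring

theorem FourPointCondition.existsUnique_geodesic [PreconnectedSpace T]
    (h : FourPointCondition T) (x y : T) :
    ∃! φ : Set.Icc (0 : ℝ) (dist x y) → T, IsGeodesicFromTo x y φ := by
  choose p hp hp' using fun t : Set.Icc (0 : ℝ) (dist x y) => h.exists_dist_eq x y t.2
  refine ⟨p, ⟨?_, ?_, ?_⟩, ?_⟩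
  · refine Isometry.of_dist_eq fun s t => ?_
    rw [h.dist_eq_abs_sub (hp s) (hp' s) (hp t) (hp' t), Subtype.dist_eq, Real.dist_eq]
  · exact (dist_eq_zero.1 (hp _)).symm
  · exact dist_eq_zero.1 (by rw [hp', sub_self])
  · intro φ hφ
    funext t
    rw [← dist_eq_zero,
      h.dist_eq_abs_sub (hφ.dist_left t) (hφ.dist_right t) (hp t) (hp' t), sub_self, abs_zero]

/-- In a connected four-point space, segments are metric intervals. -/
theorem FourPointCondition.mem_geodesicSegment_iff [PreconnectedSpace T]
    (h : FourPointCondition T) {x y z : T} :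
    z ∈ geodesicSegment x y ↔ dist x z + dist z y = dist x y := by
  refine ⟨dist_add_dist_of_mem_geodesicSegment, fun hz => ?_⟩
  obtain ⟨φ, hφ, -⟩ := h.existsUnique_geodesic x y
  have hmem : dist x z ∈ Set.Icc 0 (dist x y) :=
    ⟨dist_nonneg, by linarith [dist_nonneg (x := z) (y := y)]⟩
  refine ⟨φ, hφ, ⟨_, hmem⟩, ?_⟩
  rw [← dist_eq_zero, h.dist_eq_abs_sub (hφ.dist_left _) (hφ.dist_right _) rfl (by linarith),
    sub_self, abs_zero]

/-- A preconnected set containing the endpoints of a metric interval contains the interval. -/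
theorem FourPointCondition.mem_of_isPreconnected (h : FourPointCondition T) {S : Set T}
    (hS : IsPreconnected S) {x y z : T} (hx : x ∈ S) (hy : y ∈ S)
    (hz : dist x z + dist z y = dist x y) : z ∈ S := by
  have : PreconnectedSpace S := isPreconnected_iff_preconnectedSpace.1 hS
  have hmem : dist x z ∈ Set.Icc 0 (dist x y) :=
    ⟨dist_nonneg, by linarith [dist_nonneg (x := z) (y := y)]⟩
  -- `S` is itself a connected four-point space, so it has a point `w` at the same distances as `z`.
  obtain ⟨⟨w, hw⟩, h1, h2⟩ := (h.subtype S).exists_dist_eq ⟨x, hx⟩ ⟨y, hy⟩ hmem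
  have h3 : dist z w = 0 := by
    rw [h.dist_eq_abs_sub rfl (by linarith) h1 h2, sub_self, abs_zero]
  rwa [dist_eq_zero.1 h3]

theorem FourPointCondition.exists_median [PreconnectedSpace T] (h : FourPointCondition T)
    (x y z : T) : ∃ m, dist x m + dist m y = dist x y ∧ dist x m + dist m z = dist x z ∧
      dist z m + dist m y = dist z y := by
  have h1 := dist_triangle x y z
  have h2 := dist_triangle x z y
  have h3 := dist_triangle z x y
  rw [dist_comm z x] at h3
  rw [dist_comm y z] at h1
  -- At this Gromov product, both terms of the maximum in `h4` coincide.
  obtain ⟨m, hm, hm'⟩ := h.exists_dist_eq x y (t := (dist x y + dist x z - dist z y) / 2)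
    ⟨by linarith, by linarith⟩
  have h4 := h m z x y
  rw [dist_comm m x, dist_comm z x] at h4
  have h5 := dist_triangle x m z
  have h6 := dist_triangle z m y
  rw [dist_comm z m] at h6
  have h7 : dist m z ≤ dist x z - dist x m := by
    rcases le_max_iff.1 h4 with h4 | h4 <;> linarith
  exact ⟨m, by linarith, by linarith, by rw [dist_comm z m]; linarith⟩

theorem FourPointCondition.range_eq_geodesicSegment [PreconnectedSpace T]
    (h : FourPointCondition T) {ψ : Set.Icc (0 : ℝ) 1 → T} (hψ : Continuous ψ)
    (hinj : Function.Injective ψ) : Set.range ψ = geodesicSegment (ψ 0) (ψ 1) := by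
  ext z
  rw [h.mem_geodesicSegment_iff]
  constructor
  · rintro ⟨c, rfl⟩
    -- The median lies on the path both before and after `c`, so by injectivity it is `ψ c`.
    obtain ⟨m, hxy, hxc, hcy⟩ := h.exists_median (ψ 0) (ψ 1) (ψ c)
    obtain ⟨a, ha, ham⟩ := h.mem_of_isPreconnected
      ((isPreconnected_Icc (a := 0) (b := c)).image ψ hψ.continuousOn)
      ⟨0, ⟨le_rfl, c.2.1⟩, rfl⟩ ⟨c, ⟨c.2.1, le_rfl⟩, rfl⟩ hxc
    obtain ⟨b, hb, hbm⟩ := h.mem_of_isPreconnected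
      ((isPreconnected_Icc (a := c) (b := 1)).image ψ hψ.continuousOn)
      ⟨c, ⟨le_rfl, c.2.2⟩, rfl⟩ ⟨1, ⟨c.2.2, le_rfl⟩, rfl⟩ hcy
    have hab : a = b := hinj (ham.trans hbm.symm)
    have hac : a = c := le_antisymm ha.2 (hab ▸ hb.1)
    rwa [← hac, ham]
  · exact fun hz => h.mem_of_isPreconnected (isPreconnected_range hψ) ⟨0, rfl⟩ ⟨1, rfl⟩ hz

theorem FourPointCondition.isRealTree [ConnectedSpace T] (h : FourPointCondition T) :
    IsRealTree T where
  nonempty := inferInstance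
  existsUnique_geodesic := h.existsUnique_geodesic
  range_eq_segment _ := h.range_eq_geodesicSegment

end FourPoint

/-! ### From real trees to the four-point condition -/

namespace IsRealTree

variable {T : Type*} [MetricSpace T]

theorem connectedSpace (h : IsRealTree T) : ConnectedSpace T := by
  have := h.nonempty
  refine { toNonempty := this, isPreconnected_univ := isPreconnected_of_forall_pair fun x _ y _ => ?_ }
  obtain ⟨φ, hφ, -⟩ := h.existsUnique_geodesic x y
  have : PreconnectedSpace (Set.Icc (0 : ℝ) (dist x y)) := Subtype.preconnectedSpace
    isPreconnected_Icc
  exact ⟨Set.range φ, Set.subset_univ _, ⟨_, hφ.map_left⟩, ⟨_, hφ.map_right⟩,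
    isPreconnected_range hφ.isometry.continuous⟩

theorem left_mem_geodesicSegment (h : IsRealTree T) (x y : T) : x ∈ geodesicSegment x y := by
  obtain ⟨φ, hφ, -⟩ := h.existsUnique_geodesic x y
  exact ⟨φ, hφ, _, hφ.map_left⟩

theorem right_mem_geodesicSegment (h : IsRealTree T) (x y : T) : y ∈ geodesicSegment x y := by
  obtain ⟨φ, hφ, -⟩ := h.existsUnique_geodesic x y
  exact ⟨φ, hφ, _, hφ.map_right⟩

/-- If the initial part of a curve `F` and the final part of a curve `G` are arcs that meet only
where they are joined, the meeting point lies on the segment between the endpoints. -/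
theorem mem_geodesicSegment_of_arcs (h : IsRealTree T) {F G : ℝ → T} (hF : Continuous F)
    (hG : Continuous G) {s r d : ℝ} (hs : 0 ≤ s) (hr : r ≤ d)
    (hFinj : Set.InjOn F (Set.Icc 0 s)) (hGinj : Set.InjOn G (Set.Icc r d))
    (hjoin : F s = G r) (hmeet : ∀ a ∈ Set.Ico 0 s, ∀ b ∈ Set.Icc r d, F a ≠ G b) :
    F s ∈ geodesicSegment (F 0) (G d) := by
  rcases hs.eq_or_lt with rfl | hs
  · exact h.left_mem_geodesicSegment _ _
  rcases hr.eq_or_lt with rfl | hr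
  · exact hjoin ▸ h.right_mem_geodesicSegment _ _
  let u : ℝ → T := fun t => if t ≤ 1 / 2 then F (2 * t * s) else G (r + (2 * t - 1) * (d - r))
  have hu : Continuous u := by
    refine Continuous.if_le (by fun_prop) (by fun_prop) (by fun_prop) (by fun_prop) ?_
    rintro t rfl
    convert hjoin using 2 <;> ring
  have hFmem : ∀ {t : ℝ}, 0 ≤ t → t ≤ 1 / 2 → 2 * t * s ∈ Set.Icc 0 s := fun h0 h1 =>
    ⟨by positivity, by nlinarith⟩
  have hGmem : ∀ {t : ℝ}, 1 / 2 < t → t ≤ 1 →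
      r + (2 * t - 1) * (d - r) ∈ Set.Icc r d ∧ r < r + (2 * t - 1) * (d - r) := fun h0 h1 =>
    ⟨⟨by nlinarith, by nlinarith⟩, by nlinarith⟩
  have hcross : ∀ {a b : ℝ}, 0 ≤ a → a ≤ 1 / 2 → 1 / 2 < b → b ≤ 1 →
      F (2 * a * s) ≠ G (r + (2 * b - 1) * (d - r)) := by
    intro a b ha ha' hb hb' heq
    have hA := hFmem ha ha'
    obtain ⟨hB, hB'⟩ := hGmem hb hb'
    rcases hA.2.eq_or_lt with h1 | h1
    · rw [h1, hjoin] at heq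
      exact hB'.ne (hGinj ⟨le_rfl, hr.le⟩ hB heq)
    · exact hmeet _ ⟨hA.1, h1⟩ _ hB heq
  have hinj : Function.Injective fun t : Set.Icc (0 : ℝ) 1 => u t := by
    rintro ⟨a, ha, ha'⟩ ⟨b, hb, hb'⟩ hab
    simp only [u] at hab
    apply Subtype.ext
    show a = b
    split_ifs at hab with h1 h2 h2
    · have := hFinj (hFmem ha h1) (hFmem hb h2) hab
      nlinarith [mul_right_cancel₀ hs.ne' this]
    · exact absurd hab (hcross ha h1 (not_le.1 h2) hb')
    · exact absurd hab.symm (hcross hb h2 (not_le.1 h1) ha')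
    · have := hGinj (hGmem (not_le.1 h1) ha').1 (hGmem (not_le.1 h2) hb').1 hab
      linarith [mul_right_cancel₀ (sub_pos.2 hr).ne' (add_left_cancel this)]
  have hrange := h.range_eq_segment _ (hu.comp continuous_subtype_val) hinj
  have h0 : u 0 = F 0 := by simp [u]
  have h1 : u 1 = G d := by
    have : ¬ (1 : ℝ) ≤ 1 / 2 := by norm_num
    simp only [u, if_neg this]
    congr 1
    ring
  simp only [Function.comp_apply, Set.Icc.coe_zero, Set.Icc.coe_one, h0, h1] at hrange
  rw [← hrange]
  exact ⟨⟨1 / 2, by norm_num, by norm_num⟩, by simp [u]⟩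

/-- The median is the first point where the geodesic from `z` to `x` hits `[x, y]`: following it
that far and then `[x, y]` on to `y` gives an arc. -/
theorem exists_median (h : IsRealTree T) (x y z : T) :
    ∃ m, m ∈ geodesicSegment z x ∧ m ∈ geodesicSegment x y ∧ m ∈ geodesicSegment z y := by
  obtain ⟨φ, hφ, -⟩ := h.existsUnique_geodesic z x
  obtain ⟨χ, hχ, -⟩ := h.existsUnique_geodesic x y
  have hφc := hφ.isometry.continuous
  have hχc := hχ.isometry.continuous
  have hK : IsCompact (φ ⁻¹' Set.range χ) :=
    ((isCompact_range hχc).isClosed.preimage hφc).isCompact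
  obtain ⟨s, ⟨r, hr⟩, hmin⟩ := hK.exists_isLeast
    ⟨_, _, hχ.map_left.trans hφ.map_right.symm⟩
  refine ⟨φ s, ⟨φ, hφ, s, rfl⟩, ⟨χ, hχ, r, hr⟩, ?_⟩
  have hφe : ∀ (t : ℝ) (ht : t ∈ Set.Icc 0 (dist z x)),
      Set.IccExtend dist_nonneg φ t = φ ⟨t, ht⟩ := fun t ht => Set.IccExtend_of_mem _ _ ht
  have hχe : ∀ (t : ℝ) (ht : t ∈ Set.Icc 0 (dist x y)),
      Set.IccExtend dist_nonneg χ t = χ ⟨t, ht⟩ := fun t ht => Set.IccExtend_of_mem _ _ ht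
  have hsub : ∀ {t}, t ∈ Set.Icc 0 (s : ℝ) → t ∈ Set.Icc 0 (dist z x) := fun ht =>
    ⟨ht.1, ht.2.trans s.2.2⟩
  have hsub' : ∀ {t}, t ∈ Set.Icc (r : ℝ) (dist x y) → t ∈ Set.Icc 0 (dist x y) := fun ht =>
    ⟨r.2.1.trans ht.1, ht.2⟩
  have key := h.mem_geodesicSegment_of_arcs
    (hφc.Icc_extend' : Continuous (Set.IccExtend dist_nonneg φ))
    (hχc.Icc_extend' : Continuous (Set.IccExtend dist_nonneg χ)) s.2.1 r.2.2 ?_ ?_ ?_ ?_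
  · rwa [hφe _ s.2, hφe 0 ⟨le_rfl, dist_nonneg⟩, hχe _ ⟨dist_nonneg, le_rfl⟩, hφ.map_left,
      hχ.map_right] at key
  · intro a ha b hb hab
    rw [hφe a (hsub ha), hφe b (hsub hb)] at hab
    exact congrArg Subtype.val (hφ.isometry.injective hab)
  · intro a ha b hb hab
    rw [hχe a (hsub' ha), hχe b (hsub' hb)] at hab
    exact congrArg Subtype.val (hχ.isometry.injective hab)
  · rw [hφe _ s.2, hχe _ r.2]
    exact hr.symm
  · intro a ha b hb hab
    rw [hφe a (hsub ⟨ha.1, ha.2.le⟩), hχe b (hsub' hb)] at hab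
    exact not_le.2 ha.2 (hmin ⟨_, hab.symm⟩ : s ≤ ⟨a, hsub ⟨ha.1, ha.2.le⟩⟩)

theorem dist_eq_abs_sub_of_mem_geodesicSegment (h : IsRealTree T) {x y p q : T}
    (hp : p ∈ geodesicSegment x y) (hq : q ∈ geodesicSegment x y) :
    dist p q = |dist x p - dist x q| := by
  obtain ⟨φ, hφ, -⟩ := h.existsUnique_geodesic x y
  rw [geodesicSegment_eq_range (h.existsUnique_geodesic x y) hφ] at hp hq
  obtain ⟨s, rfl⟩ := hp
  obtain ⟨t, rfl⟩ := hq
  rw [hφ.dist_left, hφ.dist_left, hφ.isometry.dist_eq, Subtype.dist_eq, Real.dist_eq]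

theorem fourPointCondition (h : IsRealTree T) : FourPointCondition T := by
  -- Along `[w, z]`, `x` branches off at `m` and `y` at `n`, with `m` nearer `w`; bound `dist x y`
  -- by the route through `m` and `n`.
  have key : ∀ {x y z w m n : T}, m ∈ geodesicSegment w z → m ∈ geodesicSegment z x →
      m ∈ geodesicSegment w x → n ∈ geodesicSegment w z → n ∈ geodesicSegment w y →
      dist w m ≤ dist w n → dist x y + dist z w ≤ dist x z + dist y w := by
    intro x y z w m n hwz hzx hwx nwz nwy hle
    have h1 := h.dist_eq_abs_sub_of_mem_geodesicSegment nwz hwz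
    rw [abs_of_nonneg (sub_nonneg.2 hle)] at h1
    have h2 := dist_add_dist_of_mem_geodesicSegment hwz
    have h3 := dist_add_dist_of_mem_geodesicSegment hzx
    have h4 := dist_add_dist_of_mem_geodesicSegment hwx
    have h5 := dist_add_dist_of_mem_geodesicSegment nwy
    have h6 := dist_triangle4 x m n y
    rw [dist_comm m n, dist_comm x m] at h6
    rw [dist_comm z m] at h3
    rw [dist_comm z w, dist_comm x z, dist_comm y w]
    linarith
  intro x y z w
  obtain ⟨m, hwz, hzx, hwx⟩ := h.exists_median z x w
  obtain ⟨n, nwz, nzy, nwy⟩ := h.exists_median z y w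
  rcases le_total (dist w m) (dist w n) with hle | hle
  · exact le_max_of_le_left (key hwz hzx hwx nwz nwy hle)
  · refine le_max_of_le_right ?_
    rw [dist_comm x y, add_comm (dist x w)]
    exact key nwz nzy nwy hwz hwx hle

end IsRealTree

theorem theorem6p1 (T : Type*) [MetricSpace T] :
    IsRealTree T ↔
      ConnectedSpace T ∧
        ∀ x y z w : T,
          dist x y + dist z w ≤ max (dist x z + dist y w) (dist x w + dist y z) := by
  refine ⟨fun h => ⟨h.connectedSpace, h.fourPointCondition⟩, ?_⟩
  rintro ⟨_, h⟩
  exact FourPointCondition.isRealTree h
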